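/- Write $X \le_T Y$ for Turing reducibility of sets $X, Y \subseteq \omega$, $X \oplus Y = \{2x \mid x \in X\} \cup \{2x+1 \mid x \in Y\}$ for their join, and $X'$ for the Turing jump of $X$. The Turing degrees (the equivalence classes of subsets of $\omega$ under mutual Turing reducibility) form an upper semilattice under the join $\cup$ induced by $\oplus$, and the jump induces an operation $\mathbf c \mapsto \mathbf c'$ on them. For degrees $\mathbf a \le \mathbf b$, the interval $[\mathbf a, \mathbf b] = \{\mathbf y \mid \mathbf a \le \mathbf y \le \mathbf b\}$ is an upper semilattice with least element $\mathbf a$. An upper semilattice $\mathcal U$ with a least element is called $\Sigma^0_1(\mathbf c)$-presentable if there are a reflexive and transitive binary relation $\le'$ on $\omega$ that is r.e. in $\mathbf c$, and a binary operation $\lor'$ on $\omega$ that is recursive in $\mathbf c$, such that $\lor'$ is compatible with the equivalence relation $i \le' j \wedge j \le' i$, and $\mathcal U$ (with its order and its join) is isomorphic to the set of equivalence classes with the relation induced by $\le'$ and the operation induced by $\lor'$. For $n \ge 0$, $\mathcal U$ is called $\Sigma^0_{n+1}(\mathbf c)$-presentable if it is $\Sigma^0_1(\mathbf c^{(n)})$-presentable,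 where $\mathbf c^{(n)}$ is the $n$-th jump of $\mathbf c$. Lemma 2.2. For all Turing degrees $\mathbf a \le \mathbf b$, the interval $[\mathbf a, \mathbf b]$ is $\Sigma^0_3(\mathbf b)$-presentable; that is, it is $\Sigma^0_1(\mathbf b'')$-presentable. -/

import Mathlib

open Classical in
/-- The characteristic function of a set of natural numbers. -/
noncomputable def chi (A : Set ℕ) (n : ℕ) : ℕ := if n ∈ A then 1 else 0

/-- The characteristic function of `A`, as an oracle. -/
noncomputable def oracleOf (A : Set ℕ) : ℕ →. ℕ := fun n => Part.some (chi A n)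

/-- Turing reducibility of sets of natural numbers: the characteristic function of `A` is
recursive in that of `B`. -/
def SetTuringLE (A B : Set ℕ) : Prop := TuringReducible (oracleOf A) (oracleOf B)

/-- A predicate is recursively enumerable in `A` if it is the domain of a partial function that is
recursive in `A`. -/
def REPredIn {α : Type*} [Primcodable α] (A : Set ℕ) (p : α → Prop) : Prop :=
  RecursiveIn {oracleOf A} fun a => Part.assert (p a) fun _ => Part.some ()

instance : IsPreorder (Set ℕ) SetTuringLE where
  refl _ := TuringReducible.rfl
  trans _ _ _ := TuringReducible.trans

/-- The Turing degrees (of sets of natural numbers, equivalently of their characteristic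
functions), partially ordered by Turing reducibility. -/
def Degree : Type := Antisymmetrization (Set ℕ) SetTuringLE

/-- The Turing degree of a set. -/
def degree (A : Set ℕ) : Degree := toAntisymmetrization SetTuringLE A

instance : PartialOrder Degree where
  le := Quotient.lift₂ SetTuringLE fun _ _ _ _ hA hB =>
    propext ⟨fun h => (hA.2.trans h).trans hB.1, fun h => (hA.1.trans h).trans hB.2⟩
  le_refl := by rintro ⟨A⟩; exact TuringReducible.rfl
  le_trans := by rintro ⟨A⟩ ⟨B⟩ ⟨C⟩ h₁ h₂; exact TuringReducible.trans h₁ h₂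
  le_antisymm := by rintro ⟨A⟩ ⟨B⟩ h₁ h₂; exact Quotient.sound ⟨h₁, h₂⟩

theorem degree_le_degree {A B : Set ℕ} : degree A ≤ degree B ↔ SetTuringLE A B := Iff.rfl

/-! ### Basic closure properties of relative recursiveness -/

theorem setTuringLE_iff {A B : Set ℕ} :
    SetTuringLE A B ↔ Nat.RecursiveIn {oracleOf B} (fun n => Part.some (chi A n)) :=
  RecursiveIn.iff_nat

theorem recIn_comp {O : Set (ℕ →. ℕ)} {f g : ℕ → ℕ}
    (hf : Nat.RecursiveIn O (fun n => Part.some (f n)))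
    (hg : Nat.RecursiveIn O (fun n => Part.some (g n))) :
    Nat.RecursiveIn O (fun n => Part.some (f (g n))) :=
  (Nat.RecursiveIn.comp hf hg).of_eq fun n => by simp

theorem recIn_pair {O : Set (ℕ →. ℕ)} {f g : ℕ → ℕ}
    (hf : Nat.RecursiveIn O (fun n => Part.some (f n)))
    (hg : Nat.RecursiveIn O (fun n => Part.some (g n))) :
    Nat.RecursiveIn O (fun n => Part.some (Nat.pair (f n) (g n))) :=
  (Nat.RecursiveIn.pair hf hg).of_eq fun n => by simp [Seq.seq]

theorem recIn_computable {O : Set (ℕ →. ℕ)} {f : ℕ → ℕ} (hf : Computable f) :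
    Nat.RecursiveIn O (fun n => Part.some (f n)) :=
  (Nat.Partrec.recursiveIn (Partrec.nat_iff.1 hf.partrec)).of_eq fun _ => rfl

theorem recIn_chi (A : Set ℕ) :
    Nat.RecursiveIn {oracleOf A} (fun n => Part.some (chi A n)) :=
  Nat.RecursiveIn.oracle _ rfl

/-! ### The join of two degrees -/

/-- The join `A ⊕ B = {2x | x ∈ A} ∪ {2x + 1 | x ∈ B}`. -/
def setJoin (A B : Set ℕ) : Set ℕ :=
  {n | (∃ x ∈ A, n = 2 * x) ∨ ∃ x ∈ B, n = 2 * x + 1}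

theorem chi_congr {A B : Set ℕ} {m n : ℕ} (h : m ∈ A ↔ n ∈ B) : chi A m = chi B n := by
  unfold chi; split_ifs <;> tauto

theorem setTuringLE_of_reduce {A B : Set ℕ} {g : ℕ → ℕ} (hg : Computable g)
    (h : ∀ x, x ∈ A ↔ g x ∈ B) : SetTuringLE A B :=
  setTuringLE_iff.2 <| (recIn_comp (recIn_chi B) (recIn_computable hg)).of_eq fun x => by
    rw [chi_congr (h x)]

theorem left_le_setJoin (A B : Set ℕ) : SetTuringLE A (setJoin A B) :=
  setTuringLE_of_reduce (g := fun x => 2 * x)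
    (Primrec.nat_mul.comp (Primrec.const 2) Primrec.id).to_comp fun x =>
    ⟨fun h => Or.inl ⟨x, h, rfl⟩, by
      rintro (⟨y, hy, h⟩ | ⟨y, hy, h⟩)
      · obtain rfl : x = y := by omega
        exact hy
      · omega⟩

theorem right_le_setJoin (A B : Set ℕ) : SetTuringLE B (setJoin A B) :=
  setTuringLE_of_reduce (g := fun x => 2 * x + 1)
    (Primrec.succ.comp (Primrec.nat_mul.comp (Primrec.const 2) Primrec.id)).to_comp fun x =>
    ⟨fun h => Or.inr ⟨x, h, rfl⟩, by
      rintro (⟨y, hy, h⟩ | ⟨y, hy, h⟩)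
      · omega
      · obtain rfl : x = y := by omega
        exact hy⟩

theorem chi_setJoin (A B : Set ℕ) (n : ℕ) :
    chi (setJoin A B) n = if n % 2 = 0 then chi A (n / 2) else chi B (n / 2) := by
  split_ifs with h
  · refine chi_congr ⟨?_, fun hn => Or.inl ⟨_, hn, by omega⟩⟩
    rintro (⟨y, hy, rfl⟩ | ⟨y, hy, rfl⟩)
    · simpa using hy
    · omega
  · refine chi_congr ⟨?_, fun hn => Or.inr ⟨_, hn, by omega⟩⟩
    rintro (⟨y, hy, rfl⟩ | ⟨y, hy, rfl⟩)
    · omega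
    · rwa [show (2 * y + 1) / 2 = y by omega]

theorem setJoin_le {A B C : Set ℕ} (hA : SetTuringLE A C) (hB : SetTuringLE B C) :
    SetTuringLE (setJoin A B) C := by
  rw [setTuringLE_iff] at *
  have half : Computable fun n : ℕ => n / 2 := (Primrec.nat_div.comp .id (.const 2)).to_comp
  have sel : Computable fun n : ℕ => if n.unpair.1 % 2 = 0 then n.unpair.2.unpair.1
      else n.unpair.2.unpair.2 := by
    have u := Primrec.unpair
    refine (Primrec.ite (PrimrecRel.comp Primrec.eq
      (Primrec.nat_mod.comp (Primrec.fst.comp u) (.const 2)) (.const 0)) ?_ ?_).to_comp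
    · exact Primrec.fst.comp (u.comp (Primrec.snd.comp u))
    · exact Primrec.snd.comp (u.comp (Primrec.snd.comp u))
  refine (recIn_comp (recIn_computable sel) (recIn_pair (recIn_computable .id) (recIn_pair
    (recIn_comp hA (recIn_computable half)) (recIn_comp hB (recIn_computable half))))).of_eq
    fun n => ?_
  simp [chi_setJoin]

noncomputable instance : SemilatticeSup Degree where
  sup := Quotient.map₂ setJoin fun A₁ A₂ hA B₁ B₂ hB =>
    ⟨setJoin_le (hA.1.trans (left_le_setJoin _ _)) (hB.1.trans (right_le_setJoin _ _)),
      setJoin_le (hA.2.trans (left_le_setJoin _ _)) (hB.2.trans (right_le_setJoin _ _))⟩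
  le_sup_left := by rintro ⟨A⟩ ⟨B⟩; exact left_le_setJoin A B
  le_sup_right := by rintro ⟨A⟩ ⟨B⟩; exact right_le_setJoin A B
  sup_le := by rintro ⟨A⟩ ⟨B⟩ ⟨C⟩ h₁ h₂; exact setJoin_le h₁ h₂

/-! ### The Turing jump -/

/-- The initial segment of length `n` of the characteristic function of `A`. -/
noncomputable def initSeg (A : Set ℕ) (n : ℕ) : List ℕ := (List.range n).map (chi A)

/-- The `e`-th set that is recursively enumerable in `A`: the numbers `x` such that the `e`-th
partial recursive function halts on `⟨x, σ⟩` for some finite initial segment `σ` of `A`. -/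
def reSet (e : ℕ) (A : Set ℕ) : Set ℕ :=
  {x | ∃ n, ((Denumerable.ofNat Nat.Partrec.Code e).eval
    (Nat.pair x (Encodable.encode (initSeg A n)))).Dom}

/-- The Turing jump `A' = {e | e ∈ W_e^A}`. -/
def jumpSet (A : Set ℕ) : Set ℕ := {e | e ∈ reSet e A}

theorem initSeg_getElem? (A : Set ℕ) (n x : ℕ) :
    (initSeg A n)[x]? = if x < n then some (chi A x) else none := by
  unfold initSeg
  split_ifs with h <;> simp [h]

/-- The use principle: a computation relative to `A` only uses a finite initial segment of `A`. -/
theorem use_principle {A : Set ℕ} {f : ℕ →. ℕ} (hf : Nat.RecursiveIn {oracleOf A} f) :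
    ∃ F : List ℕ → ℕ →. ℕ, Partrec₂ F ∧
      (∀ m n x y, m ≤ n → y ∈ F (initSeg A m) x → y ∈ F (initSeg A n) x) ∧
      ∀ x y, y ∈ f x ↔ ∃ n, y ∈ F (initSeg A n) x := by
  have total : ∀ {g : ℕ → ℕ}, Computable g → ∃ F : List ℕ → ℕ →. ℕ, Partrec₂ F ∧
      (∀ m n x y, m ≤ n → y ∈ F (initSeg A m) x → y ∈ F (initSeg A n) x) ∧
      ∀ x y, y ∈ Part.some (g x) ↔ ∃ n, y ∈ F (initSeg A n) x := fun {g} hg =>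
    ⟨fun _ x => Part.some (g x), (hg.comp Computable.snd).partrec, fun _ _ _ _ _ h => h,
      fun x y => by simp⟩
  induction hf with
  | zero => exact total (Computable.const 0)
  | succ => exact total Computable.succ
  | left => exact total (Computable.fst.comp Computable.unpair)
  | right => exact total (Computable.snd.comp Computable.unpair)
  | oracle g hg =>
    obtain rfl := Set.mem_singleton_iff.1 hg
    refine ⟨fun σ x => (σ[x]? : Part ℕ), Computable.ofOption Computable.list_getElem?, ?_, ?_⟩
    · intro m n x y hmn
      simp only [initSeg_getElem?]
      split_ifs <;> first | omega | simp
    · intro x y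
      simp only [initSeg_getElem?, oracleOf, Part.mem_some_iff, Part.mem_coe]
      constructor
      · rintro rfl
        exact ⟨x + 1, by simp⟩
      · rintro ⟨n, hn⟩
        split_ifs at hn <;> simp_all
  | @pair f h _ _ ihf ihh =>
    obtain ⟨F, hF, mF, eF⟩ := ihf
    obtain ⟨H, hH, mH, eH⟩ := ihh
    refine ⟨fun σ x => (F σ x).bind fun a => (H σ x).map fun b => Nat.pair a b, ?_, ?_, ?_⟩
    · refine Partrec.bind hF (Partrec.map (hH.comp (Computable.fst.comp Computable.fst)
        (Computable.snd.comp Computable.fst)) ?_)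
      exact Primrec₂.natPair.to_comp.comp (Computable.snd.comp Computable.fst) Computable.snd
    · intro m n x y hmn
      simp only [Part.mem_bind_iff, Part.mem_map_iff]
      rintro ⟨a, ha, b, hb, rfl⟩
      exact ⟨a, mF _ _ _ _ hmn ha, b, mH _ _ _ _ hmn hb, rfl⟩
    · intro x y
      simp only [Seq.seq, Part.mem_bind_iff, Part.mem_map_iff, Part.map_eq_map]
      constructor
      · rintro ⟨_, ⟨a, ha, rfl⟩, b, hb, rfl⟩
        obtain ⟨m, hm⟩ := (eF _ _).1 ha
        obtain ⟨n, hn⟩ := (eH _ _).1 hb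
        exact ⟨max m n, a, mF _ _ _ _ (le_max_left _ _) hm, b,
          mH _ _ _ _ (le_max_right _ _) hn, rfl⟩
      · rintro ⟨n, a, ha, b, hb, rfl⟩
        exact ⟨_, ⟨a, (eF _ _).2 ⟨n, ha⟩, rfl⟩, b, (eH _ _).2 ⟨n, hb⟩, rfl⟩
  | @comp f h _ _ ihf ihh =>
    obtain ⟨F, hF, mF, eF⟩ := ihf
    obtain ⟨H, hH, mH, eH⟩ := ihh
    refine ⟨fun σ x => (H σ x).bind fun a => F σ a, ?_, ?_, ?_⟩
    · exact Partrec.bind hH (hF.comp (Computable.fst.comp Computable.fst) Computable.snd)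
    · intro m n x y hmn hy
      obtain ⟨a, ha, hb⟩ := Part.mem_bind_iff.1 hy
      exact Part.mem_bind_iff.2 ⟨a, mH _ _ _ _ hmn ha, mF _ _ _ _ hmn hb⟩
    · intro x y
      constructor
      · intro hy
        obtain ⟨a, ha, hb⟩ := Part.mem_bind_iff.1 hy
        obtain ⟨m, hm⟩ := (eH _ _).1 ha
        obtain ⟨n, hn⟩ := (eF _ _).1 hb
        exact ⟨max m n, Part.mem_bind_iff.2
          ⟨a, mH _ _ _ _ (le_max_left _ _) hm, mF _ _ _ _ (le_max_right _ _) hn⟩⟩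
      · rintro ⟨n, hy⟩
        obtain ⟨a, ha, hb⟩ := Part.mem_bind_iff.1 hy
        exact Part.mem_bind_iff.2 ⟨a, (eH _ _).2 ⟨n, ha⟩, (eF _ _).2 ⟨n, hb⟩⟩
  | @prec f h _ _ ihf ihh =>
    obtain ⟨F, hF, mF, eF⟩ := ihf
    obtain ⟨H, hH, mH, eH⟩ := ihh
    have mono : ∀ z k m n y, m ≤ n →
        y ∈ Nat.rec (motive := fun _ => Part ℕ) (F (initSeg A m) z) (fun y IH => IH.bind
          fun i => H (initSeg A m) (Nat.pair z (Nat.pair y i))) k →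
        y ∈ Nat.rec (motive := fun _ => Part ℕ) (F (initSeg A n) z) (fun y IH => IH.bind
          fun i => H (initSeg A n) (Nat.pair z (Nat.pair y i))) k := by
      intro z k m n
      induction k with
      | zero => exact fun y hmn => mF _ _ _ _ hmn
      | succ k ih =>
        intro y hmn hy
        obtain ⟨a, ha, hb⟩ := Part.mem_bind_iff.1 hy
        exact Part.mem_bind_iff.2 ⟨a, ih _ hmn ha, mH _ _ _ _ hmn hb⟩
    refine ⟨fun σ p => Nat.rec (motive := fun _ => Part ℕ) (F σ p.unpair.1) (fun y IH => IH.bind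
      fun i => H σ (Nat.pair p.unpair.1 (Nat.pair y i))) p.unpair.2, ?_,
      fun m n x y => mono _ _ m n y, ?_⟩
    · have u : Computable fun q : List ℕ × ℕ => q.2.unpair :=
        Computable.unpair.comp Computable.snd
      have step : Partrec₂ fun (q : List ℕ × ℕ) (r : ℕ × ℕ) =>
          H q.1 (Nat.pair q.2.unpair.1 (Nat.pair r.1 r.2)) := by
        refine hH.comp (Computable.fst.comp Computable.fst) ?_
        exact Primrec₂.natPair.to_comp.comp (Computable.fst.comp (u.comp Computable.fst))
          (Primrec₂.natPair.to_comp.comp (Computable.fst.comp Computable.snd)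
            (Computable.snd.comp Computable.snd))
      exact Partrec.nat_rec (Computable.snd.comp u)
        (hF.comp Computable.fst (Computable.fst.comp u)) step
    · intro x
      have key : ∀ z k y, y ∈ Nat.rec (motive := fun _ => Part ℕ) (f z) (fun y IH => IH.bind
          fun i => h (Nat.pair z (Nat.pair y i))) k ↔ ∃ n,
          y ∈ Nat.rec (motive := fun _ => Part ℕ) (F (initSeg A n) z) (fun y IH => IH.bind
            fun i => H (initSeg A n) (Nat.pair z (Nat.pair y i))) k := by
        intro z k
        induction k with
        | zero => exact fun y => eF _ _
        | succ k ih =>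
          intro y
          constructor
          · intro hy
            obtain ⟨a, ha, hb⟩ := Part.mem_bind_iff.1 hy
            obtain ⟨m, hm⟩ := (ih _).1 ha
            obtain ⟨n, hn⟩ := (eH _ _).1 hb
            exact ⟨max m n, Part.mem_bind_iff.2
              ⟨a, mono _ _ _ _ _ (le_max_left _ _) hm, mH _ _ _ _ (le_max_right _ _) hn⟩⟩
          · rintro ⟨n, hy⟩
            obtain ⟨a, ha, hb⟩ := Part.mem_bind_iff.1 hy
            exact Part.mem_bind_iff.2 ⟨a, (ih _).2 ⟨n, ha⟩, (eH _ _).2 ⟨n, hb⟩⟩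
      exact key _ _
  | @rfind f _ ihf =>
    obtain ⟨F, hF, mF, eF⟩ := ihf
    have test : ∀ (b : Bool) (x : Part ℕ), b ∈ x.map (fun m => decide (m = 0)) ↔
        ∃ a ∈ x, decide (a = 0) = b := fun b x => Part.mem_map_iff _
    refine ⟨fun σ a => Nat.rfind fun n => (F σ (Nat.pair a n)).map fun m => decide (m = 0),
      ?_, ?_, ?_⟩
    · refine Partrec.rfind (Partrec.map (hF.comp (Computable.fst.comp Computable.fst)
        (Primrec₂.natPair.to_comp.comp (Computable.snd.comp Computable.fst) Computable.snd)) ?_)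
      exact (PrimrecRel.comp Primrec.eq Primrec.snd (Primrec.const 0)).decide.to_comp
    · intro m n x y hmn hy
      obtain ⟨h₀, h⟩ := Nat.mem_rfind.1 hy
      refine Nat.mem_rfind.2 ⟨?_, fun {k} hk => ?_⟩
      · obtain ⟨a, ha, h0⟩ := (test _ _).1 h₀
        exact (test _ _).2 ⟨a, mF _ _ _ _ hmn ha, h0⟩
      · obtain ⟨b, hb, h1⟩ := (test _ _).1 (h hk)
        exact (test _ _).2 ⟨b, mF _ _ _ _ hmn hb, h1⟩
    · intro x y
      constructor
      · intro hy
        obtain ⟨h₀, h⟩ := Nat.mem_rfind.1 hy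
        obtain ⟨a, ha, h0⟩ := (test _ _).1 h₀
        obtain ⟨n₀, hn₀⟩ := (eF _ _).1 ha
        have bound : ∀ z ≤ y, ∃ N, ∀ k < z, ∃ b, b ∈ F (initSeg A N) (Nat.pair x k) ∧
            decide (b = 0) = false := by
          intro z hz
          induction z with
          | zero => exact ⟨0, by simp⟩
          | succ z ih =>
            obtain ⟨N, hN⟩ := ih (by omega)
            obtain ⟨b, hb, h1⟩ := (test _ _).1 (h (m := z) (by omega))
            obtain ⟨M, hM⟩ := (eF _ _).1 hb
            refine ⟨max N M, fun k hk => ?_⟩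
            rcases Nat.lt_succ_iff_lt_or_eq.1 hk with hk | rfl
            · obtain ⟨c, hc, h2⟩ := hN k hk
              exact ⟨c, mF _ _ _ _ (le_max_left _ _) hc, h2⟩
            · exact ⟨b, mF _ _ _ _ (le_max_right _ _) hM, h1⟩
        obtain ⟨N, hN⟩ := bound y le_rfl
        refine ⟨max n₀ N, Nat.mem_rfind.2
          ⟨(test _ _).2 ⟨a, mF _ _ _ _ (le_max_left _ _) hn₀, h0⟩, fun {k} hk => ?_⟩⟩
        obtain ⟨c, hc, h2⟩ := hN k hk
        exact (test _ _).2 ⟨c, mF _ _ _ _ (le_max_right _ _) hc, h2⟩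
      · rintro ⟨n, hy⟩
        obtain ⟨h₀, h⟩ := Nat.mem_rfind.1 hy
        obtain ⟨a, ha, h0⟩ := (test _ _).1 h₀
        refine Nat.mem_rfind.2 ⟨(test _ _).2 ⟨a, (eF _ _).2 ⟨n, ha⟩, h0⟩, fun {k} hk => ?_⟩
        obtain ⟨b, hb, h1⟩ := (test _ _).1 (h hk)
        exact (test _ _).2 ⟨b, (eF _ _).2 ⟨n, hb⟩, h1⟩

/-- Every predicate that is r.e. in `A` is many-one reducible to the jump of `A`. -/
theorem REPredIn.reduces_jumpSet {α : Type*} [Primcodable α] {A : Set ℕ} {p : α → Prop}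
    (hp : REPredIn A p) :
    ∃ g : ℕ → ℕ, Computable g ∧ ∀ a, p a ↔ g (Encodable.encode a) ∈ jumpSet A := by
  obtain ⟨F, hF, -, eF⟩ := use_principle hp
  have hK : Partrec fun z : ℕ =>
      F (Denumerable.ofNat (List ℕ) z.unpair.2.unpair.2) z.unpair.1 :=
    hF.comp ((Computable.ofNat _).comp (Computable.snd.comp (Computable.unpair.comp
      (Computable.snd.comp Computable.unpair)))) (Computable.fst.comp Computable.unpair)
  obtain ⟨c, hc⟩ := Nat.Partrec.Code.exists_code.1 (Partrec.nat_iff.1 hK)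
  refine ⟨fun x => Encodable.encode (c.curry x), Computable.encode.comp
    (Nat.Partrec.Code.primrec₂_curry.to_comp.comp (Computable.const c) Computable.id),
    fun a => ?_⟩
  have h₁ : p a ↔ ∃ y, y ∈ Part.bind (Encodable.decode (α := α) (Encodable.encode a) : Part α)
      fun a => (Part.assert (p a) fun _ => Part.some ()).map Encodable.encode := by
    simp
  rw [h₁]
  simp only [eF, jumpSet, reSet, Set.mem_ofPred_eq, Denumerable.ofNat_encode,
    Nat.Partrec.Code.eval_curry, hc, Nat.unpair_pair, Part.dom_iff_mem]
  exact exists_comm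

theorem REPredIn.mono {α : Type*} [Primcodable α] {A B : Set ℕ} {p : α → Prop}
    (hp : REPredIn A p) (h : SetTuringLE A B) : REPredIn B p :=
  RecursiveIn.subst hp fun g hg => by
    obtain rfl := Set.mem_singleton_iff.1 hg
    exact h

/-- The code of the initial segment of length `n` of `A` is recursive in `A`. -/
theorem recIn_initSeg (A : Set ℕ) :
    Nat.RecursiveIn {oracleOf A} (fun n => Part.some (Encodable.encode (initSeg A n))) := by
  have app : Computable fun n : ℕ =>
      Encodable.encode (Denumerable.ofNat (List ℕ) n.unpair.1 ++ [n.unpair.2]) :=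
    Computable.encode.comp (Computable.list_concat.comp
      ((Computable.ofNat _).comp (Computable.fst.comp Computable.unpair))
      (Computable.snd.comp Computable.unpair))
  have c21 : Computable fun n : ℕ => n.unpair.2.unpair.1 :=
    Computable.fst.comp (Computable.unpair.comp (Computable.snd.comp Computable.unpair))
  have c22 : Computable fun n : ℕ => n.unpair.2.unpair.2 :=
    Computable.snd.comp (Computable.unpair.comp (Computable.snd.comp Computable.unpair))
  have step := recIn_comp (recIn_computable app) (recIn_pair (recIn_computable c22)
    (recIn_comp (recIn_chi A) (recIn_computable c21)))
  have base := recIn_computable (O := {oracleOf A})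
    (Computable.const (α := ℕ) (Encodable.encode ([] : List ℕ)))
  refine (Nat.RecursiveIn.comp (Nat.RecursiveIn.prec base step) (recIn_computable
    (Primrec₂.natPair.to_comp.comp (Computable.const 0) Computable.id))).of_eq fun n => ?_
  simp only [Part.bind_eq_bind, Part.bind_some, Nat.unpair_pair, id]
  induction n with
  | zero => simp [initSeg]
  | succ n ih =>
    refine (congrArg (fun p : Part ℕ => p.bind _) ih).trans ?_
    simp [initSeg, List.range_succ]

/-- The jump of `A` is r.e. in `A`. -/
theorem rePredIn_jumpSet (A : Set ℕ) : REPredIn A (fun e => e ∈ jumpSet A) := by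
  have test : Computable fun z : ℕ =>
      if (Nat.Partrec.Code.evaln z.unpair.1.unpair.2.unpair.2
        (Denumerable.ofNat Nat.Partrec.Code z.unpair.1.unpair.1)
        (Nat.pair z.unpair.1.unpair.1 z.unpair.2)).isSome = true then 0 else 1 := by
    have u := Primrec.unpair
    have z1 : Primrec fun z : ℕ => z.unpair.1 := Primrec.fst.comp u
    have z11 : Primrec fun z : ℕ => z.unpair.1.unpair.1 := Primrec.fst.comp (u.comp z1)
    have z122 : Primrec fun z : ℕ => z.unpair.1.unpair.2.unpair.2 :=
      Primrec.snd.comp (u.comp (Primrec.snd.comp (u.comp z1)))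
    have ev := Nat.Partrec.Code.primrec_evaln.comp
      (((z122.pair ((Primrec.ofNat Nat.Partrec.Code).comp z11)).pair
        (Primrec₂.natPair.comp z11 (Primrec.snd.comp u))))
    exact (Primrec.ite (PrimrecRel.comp Primrec.eq (Primrec.option_isSome.comp ev)
      (Primrec.const true)) (Primrec.const 0) (Primrec.const 1)).to_comp
  have c21 : Computable fun n : ℕ => n.unpair.2.unpair.1 :=
    Computable.fst.comp (Computable.unpair.comp (Computable.snd.comp Computable.unpair))
  have step := recIn_comp (recIn_computable test) (recIn_pair (recIn_computable .id)
    (recIn_comp (recIn_initSeg A) (recIn_computable c21)))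
  refine (Nat.RecursiveIn.comp (recIn_computable (Computable.const 0))
    (Nat.RecursiveIn.rfind step)).of_eq fun e => ?_
  simp only [Part.bind_eq_bind, Encodable.decode_nat, Part.coe_some, Part.bind_some]
  have hdom : (Nat.rfind fun n => (fun m : ℕ => decide (m = 0)) <$> Part.some
      (if (Nat.Partrec.Code.evaln (Nat.pair e n).unpair.2.unpair.2
        (Denumerable.ofNat Nat.Partrec.Code (Nat.pair e n).unpair.1)
        (Nat.pair (Nat.pair e n).unpair.1
          (Encodable.encode (initSeg A (Nat.pair e n).unpair.2.unpair.1)))).isSome = true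
        then 0 else 1)).Dom ↔ e ∈ jumpSet A := by
    refine Nat.rfind_dom'.trans ?_
    simp only [Part.map_eq_map, Part.map_some, Part.mem_some_iff, Nat.unpair_pair, jumpSet, reSet,
      Set.mem_ofPred_eq, Part.dom_iff_mem, Nat.Partrec.Code.evaln_complete]
    constructor
    · rintro ⟨k, hk, -⟩
      split_ifs at hk with h
      · obtain ⟨y, hy⟩ := Option.isSome_iff_exists.1 h
        exact ⟨_, y, _, hy⟩
      · simp at hk
    · rintro ⟨n, y, s, hy⟩
      refine ⟨Nat.pair n s, ?_, fun _ => ⟨_, rfl⟩⟩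
      rw [Option.mem_def] at hy
      simp [hy]
  refine Part.ext' ?_ ?_
  · simpa [Part.bind_dom, Part.assert] using hdom
  · intro _ _
    rfl

/-- The jump is monotone, hence induces an operation on degrees. -/
theorem jumpSet_mono {A B : Set ℕ} (h : SetTuringLE A B) :
    SetTuringLE (jumpSet A) (jumpSet B) := by
  obtain ⟨g, hg, hgA⟩ := ((rePredIn_jumpSet A).mono h).reduces_jumpSet
  exact setTuringLE_of_reduce hg hgA

/-- The Turing jump of a degree. -/
def jump : Degree → Degree :=
  Quotient.map jumpSet fun _ _ h => ⟨jumpSet_mono h.1, jumpSet_mono h.2⟩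

/-! ### Presentations of upper semilattices -/

/-- A structure `(ω, ≤', ∨')` such that `≤'` is transitive and reflexive and `∨'` induces an
operation on the classes of the equivalence relation `i ≤' j ∧ j ≤' i`. -/
structure Presentation where
  /-- the relation `≤'` -/
  le' : ℕ → ℕ → Prop
  /-- the operation `∨'` -/
  join' : ℕ → ℕ → ℕ
  refl' : ∀ i, le' i i
  trans' : ∀ i j k, le' i j → le' j k → le' i k
  join_congr' : ∀ i₁ i₂ j₁ j₂, AntisymmRel le' i₁ i₂ → AntisymmRel le' j₁ j₂ →
    AntisymmRel le' (join' i₁ j₁) (join' i₂ j₂)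

namespace Presentation

variable (P : Presentation)

/-- The equivalence relation `i ≤' j ∧ j ≤' i`. -/
def setoid : Setoid ℕ where
  r := AntisymmRel P.le'
  iseqv := ⟨fun i => ⟨P.refl' i, P.refl' i⟩, fun h => ⟨h.2, h.1⟩,
    fun h₁ h₂ => ⟨P.trans' _ _ _ h₁.1 h₂.1, P.trans' _ _ _ h₂.2 h₁.2⟩⟩

/-- The set `L` of equivalence classes. -/
def Carrier : Type := Quotient P.setoid

/-- The relation on `L` induced by `≤'`. -/
def le : P.Carrier → P.Carrier → Prop :=
  Quotient.lift₂ P.le' fun _ _ _ _ hi hj => propext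
    ⟨fun h => P.trans' _ _ _ hi.2 (P.trans' _ _ _ h hj.1),
      fun h => P.trans' _ _ _ hi.1 (P.trans' _ _ _ h hj.2)⟩

/-- The operation on `L` induced by `∨'`. -/
def join : P.Carrier → P.Carrier → P.Carrier :=
  Quotient.map₂ P.join' fun _ _ hi _ _ hj => P.join_congr' _ _ _ _ hi hj

end Presentation

/-- The upper semilattice `U` with least element is `Σ⁰₁(a)`-presentable: it is isomorphic to
the quotient `(L, ≤, ∨)` of a structure `(ω, ≤', ∨')` with `≤'` r.e. in `a` and `∨'` recursive
in `a`. -/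
def Sigma1Presentable (a : Degree) (U : Type*) [SemilatticeSup U] [OrderBot U] : Prop :=
  ∃ (A : Set ℕ) (P : Presentation), degree A = a ∧
    REPredIn A (fun p : ℕ × ℕ => P.le' p.1 p.2) ∧
    ComputableIn₂ {oracleOf A} P.join' ∧
    ∃ φ : P.Carrier ≃ U, (∀ x y, P.le x y ↔ φ x ≤ φ y) ∧ ∀ x y, φ (P.join x y) = φ x ⊔ φ y

/-- `U` is `Σ⁰ₙ₊₁(a)`-presentable if it is `Σ⁰₁(a⁽ⁿ⁾)`-presentable, where `a⁽ⁿ⁾` is the `n`-th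
jump of `a`. -/
def SigmaSuccPresentable (n : ℕ) (a : Degree) (U : Type*) [SemilatticeSup U] [OrderBot U] : Prop :=
  Sigma1Presentable (jump^[n] a) U

/-!
# Intervals of Turing degrees are `Σ⁰₃`-presentable over their top

Let `A ≤ B`. The members of the interval between the degrees of `A` and `B` are the degrees of the
sets `indexedSet A B e = A ⊕ {x | φₑᴮ(x) = 1}`, where `e` ranges over the indices of total functions
recursive in `B`, so these indices can serve as names.

* Totality of `φₑᴮ` is a `Π⁰₂` predicate in `B`, hence recursive in `B''`
  (`REPredIn.forall_le_jumpSet_jumpSet`, `totalIndices_le`). Therefore a function recursive in `B''`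
  can replace every other number by a fixed total index, and all of `ω` becomes a set of names.
* On total indices, `indexedSet A B e` is recursive in `B` uniformly in `e`
  (`exists_recIn_chi_indexedSet`). Hence "the program `d` with oracle `indexedSet A B i` computes
  `indexedSet A B e`" is again `Π⁰₂` in `B`, by the uniformity of the universal function
  (`recIn_phi_uniform`), and the existence of such a `d` is r.e. in `B''`
  (`exists_rePredIn_indexedSet_le`). This is the relation `≤'`.
* The parametrization theorem (`exists_phi_eq`) gives a computable operation on total indices that
  represents the join of degrees (`exists_join_index`).
-/

open Nat.Partrec (Code)

/-! ### The arithmetical hierarchy relative to an oracle -/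

theorem recIn_pair_part {O : Set (ℕ →. ℕ)} {f g : ℕ →. ℕ} (hf : Nat.RecursiveIn O f)
    (hg : Nat.RecursiveIn O g) :
    Nat.RecursiveIn O (fun n => (f n).bind fun a => (g n).map fun b => Nat.pair a b) :=
  (Nat.RecursiveIn.pair hf hg).of_eq fun n => by
    simp [Seq.seq, Part.bind_map]

theorem recIn_map {O : Set (ℕ →. ℕ)} {f : ℕ →. ℕ} {g : ℕ → ℕ} (hf : Nat.RecursiveIn O f)
    (hg : Computable g) : Nat.RecursiveIn O (fun n => (f n).map g) :=
  (Nat.RecursiveIn.comp (recIn_computable hg) hf).of_eq fun n => by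
    simp [Part.bind_some_eq_map]

theorem recIn_precomp {O : Set (ℕ →. ℕ)} {f : ℕ →. ℕ} {g : ℕ → ℕ} (hf : Nat.RecursiveIn O f)
    (hg : Nat.RecursiveIn O fun n => Part.some (g n)) : Nat.RecursiveIn O (fun n => f (g n)) :=
  (Nat.RecursiveIn.comp hf hg).of_eq fun n => Part.bind_some (g n) f

theorem rePredIn_of_dom {X : Set ℕ} {p : ℕ → Prop} {f : ℕ →. ℕ}
    (hf : Nat.RecursiveIn {oracleOf X} f) (h : ∀ n, p n ↔ (f n).Dom) : REPredIn X p := by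
  refine (recIn_map hf (Computable.const 0)).of_eq fun n => Part.ext' ?_ fun _ _ => rfl
  simp [Part.assert, h]

theorem rePredIn_exists {X C : Set ℕ} (hC : SetTuringLE C X) :
    REPredIn X fun n => ∃ k, Nat.pair n k ∈ C := by
  have h := Nat.RecursiveIn.rfind (recIn_map (setTuringLE_iff.1 hC)
    (Primrec.nat_sub.comp (.const 1) .id).to_comp)
  refine rePredIn_of_dom h fun n => ?_
  refine Iff.trans ?_ Nat.rfind_dom'.symm
  refine exists_congr fun k => ?_
  by_cases hk : Nat.pair n k ∈ C <;> simp [chi, hk]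

theorem rePredIn_zero_mem {X : Set ℕ} {f : ℕ →. ℕ} (hf : Nat.RecursiveIn {oracleOf X} f) :
    REPredIn X fun n => 0 ∈ f n := by
  have h := Nat.RecursiveIn.rfind (recIn_precomp hf
    (recIn_computable (Computable.fst.comp Computable.unpair)))
  refine rePredIn_of_dom h fun n => ?_
  refine Iff.trans ?_ Nat.rfind_dom'.symm
  simp only [Nat.unpair_pair, Part.map_eq_map, Part.mem_map_iff, decide_eq_true_eq]
  constructor
  · intro h0
    exact ⟨0, ⟨0, h0, rfl⟩, fun _ => Part.dom_iff_mem.2 ⟨_, Part.mem_map _ h0⟩⟩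
  · rintro ⟨_, ⟨a, ha, rfl⟩, -⟩
    exact ha

theorem REPredIn.precomp {α : Type*} [Primcodable α] {X : Set ℕ} {p : ℕ → Prop} {g : α → ℕ}
    (hp : REPredIn X p) (hg : ComputableIn {oracleOf X} g) : REPredIn X fun a => p (g a) := by
  have h : Nat.RecursiveIn {oracleOf X} _ := hp
  refine (Nat.RecursiveIn.comp h hg).of_eq fun n => ?_
  cases hn : (Encodable.decode n : Option α) <;> simp

theorem REPredIn.le_jumpSet {X C : Set ℕ} (h : REPredIn X (· ∈ C)) :
    SetTuringLE C (jumpSet X) := by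
  obtain ⟨g, hg, hgC⟩ := h.reduces_jumpSet
  exact setTuringLE_of_reduce hg hgC

theorem compl_setTuringLE {X C : Set ℕ} (h : SetTuringLE C X) : SetTuringLE Cᶜ X := by
  rw [setTuringLE_iff] at *
  refine (recIn_map h (Primrec.nat_sub.comp (.const 1) .id).to_comp).of_eq fun n => ?_
  by_cases hn : n ∈ C <;> simp [chi, hn]

/-- A `Π⁰₂` predicate is recursive in the double jump. -/
theorem REPredIn.forall_le_jumpSet_jumpSet {X C : Set ℕ} (h : REPredIn X (· ∈ C)) :
    SetTuringLE {n | ∀ k, Nat.pair n k ∈ C} (jumpSet (jumpSet X)) := by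
  have h₁ : REPredIn (jumpSet X) (· ∈ {n | ∃ k, Nat.pair n k ∈ Cᶜ}) :=
    rePredIn_exists (compl_setTuringLE h.le_jumpSet)
  convert compl_setTuringLE h₁.le_jumpSet using 1
  ext n
  simp

/-! ### A universal function -/

/-- Whether `k = ⟨y, s, n⟩` witnesses that the program `d` outputs `y` on the input `⟨x, σ⟩`
within the time bound `s`. The number `n` is the length of the oracle segment coded by `σ`. -/
def hit (d x k σ : ℕ) : Bool :=
  decide (Code.evaln k.unpair.2.unpair.1 (Denumerable.ofNat Code d) (Nat.pair x σ) =
    some k.unpair.1)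

/-- The value at `x` of the `d`-th partial function recursive in `X`. A program reads an initial
segment of the oracle as part of its input; the outputs for different segments may disagree, and
the value is the output found first. -/
noncomputable def phi (X : Set ℕ) (d x : ℕ) : Part ℕ :=
  (Nat.rfind fun k => Part.some
    (hit d x k (Encodable.encode (initSeg X k.unpair.2.unpair.2)))).map fun k => k.unpair.1

theorem exists_mem_of_mem_phi {X : Set ℕ} {d x y : ℕ} (h : y ∈ phi X d x) :
    ∃ n, y ∈ (Denumerable.ofNat Code d).eval
      (Nat.pair x (Encodable.encode (initSeg X n))) := by
  obtain ⟨k, hk, rfl⟩ := (Part.mem_map_iff _).1 h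
  have := Nat.rfind_spec hk
  simp only [Part.mem_some_iff, hit, eq_comm (a := true), decide_eq_true_eq] at this
  exact ⟨_, Code.evaln_sound this⟩

theorem phi_dom_of_mem {X : Set ℕ} {d x y n : ℕ} (h : y ∈ (Denumerable.ofNat Code d).eval
    (Nat.pair x (Encodable.encode (initSeg X n)))) : (phi X d x).Dom := by
  obtain ⟨s, hs⟩ := Code.evaln_complete.1 h
  refine Nat.rfind_dom'.2 ⟨Nat.pair y (Nat.pair s n), ?_, fun _ => trivial⟩
  simpa [hit] using hs

/-- Parametrization: a function recursive in `X` of a parameter `p` and an argument `x` is a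
computable family, indexed by `p`, of functions `phi X (s p)`. -/
theorem exists_phi_eq {X : Set ℕ} {f : ℕ →. ℕ} (hf : Nat.RecursiveIn {oracleOf X} f) :
    ∃ s : ℕ → ℕ, Computable s ∧ ∀ p x, phi X (s p) x = f (Nat.pair p x) := by
  obtain ⟨F, hF, -, eF⟩ := use_principle hf
  have u := Computable.unpair
  have z2 : Computable fun z : ℕ => z.unpair.2.unpair := u.comp (Computable.snd.comp u)
  have hK : Partrec fun z : ℕ => F (Denumerable.ofNat (List ℕ) z.unpair.2.unpair.2)
      (Nat.pair z.unpair.1 z.unpair.2.unpair.1) :=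
    hF.comp ((Computable.ofNat _).comp (Computable.snd.comp z2))
      (Primrec₂.natPair.to_comp.comp (Computable.fst.comp u) (Computable.fst.comp z2))
  obtain ⟨c, hc⟩ := Code.exists_code.1 (Partrec.nat_iff.1 hK)
  refine ⟨fun p => Encodable.encode (c.curry p), Computable.encode.comp
    (Code.primrec₂_curry.to_comp.comp (Computable.const c) Computable.id), fun p x => ?_⟩
  have ev : ∀ n, (Denumerable.ofNat Code (Encodable.encode (c.curry p))).eval
      (Nat.pair x (Encodable.encode (initSeg X n))) = F (initSeg X n) (Nat.pair p x) := by
    intro n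
    simp [Code.eval_curry, hc]
  have sound : ∀ y ∈ phi X (Encodable.encode (c.curry p)) x, y ∈ f (Nat.pair p x) := by
    intro y hy
    obtain ⟨n, hn⟩ := exists_mem_of_mem_phi hy
    exact (eF _ _).2 ⟨n, ev n ▸ hn⟩
  refine Part.ext fun y => ⟨sound y, fun hy => ?_⟩
  obtain ⟨n, hn⟩ := (eF _ _).1 hy
  obtain ⟨y', hy'⟩ := Part.dom_iff_mem.1 (phi_dom_of_mem (ev n ▸ hn))
  exact Part.mem_unique (sound _ hy') hy ▸ hy'

/-- `phi` is uniformly recursive in the oracle: if the sets `X` with index `i` are computed from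
`O` by one function `S`, then so are the functions `phi X d`. -/
theorem recIn_phi_uniform {O : Set (ℕ →. ℕ)} {S : ℕ →. ℕ} (hS : Nat.RecursiveIn O S) :
    ∃ V : ℕ →. ℕ, Nat.RecursiveIn O V ∧ ∀ i X, (∀ j, S (Nat.pair i j) = Part.some (chi X j)) →
      ∀ d x, V (Nat.pair i (Nat.pair d x)) = phi X d x := by
  have u := Primrec.unpair
  have u1 : Primrec fun z : ℕ => z.unpair.1 := Primrec.fst.comp u
  have u2 : Primrec fun z : ℕ => z.unpair.2 := Primrec.snd.comp u
  have app : Primrec fun n : ℕ =>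
      Encodable.encode (Denumerable.ofNat (List ℕ) n.unpair.1 ++ [n.unpair.2]) :=
    Primrec.encode.comp (Primrec.list_concat.comp ((Primrec.ofNat _).comp u1) u2)
  have step := Nat.RecursiveIn.comp (recIn_computable app.to_comp) (recIn_pair_part
    (recIn_computable (u2.comp u2).to_comp)
    (recIn_precomp hS (recIn_computable (Primrec₂.natPair.comp u1 (u1.comp u2)).to_comp)))
  -- `L ⟨i, n⟩` is the code of the initial segment of length `n` of the set with index `i`.
  obtain ⟨L, hL, eL⟩ : ∃ L : ℕ →. ℕ, Nat.RecursiveIn O L ∧ ∀ i X,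
      (∀ j, S (Nat.pair i j) = Part.some (chi X j)) →
      ∀ n, L (Nat.pair i n) = Part.some (Encodable.encode (initSeg X n)) := by
    refine ⟨_, Nat.RecursiveIn.prec (recIn_computable (Computable.const (α := ℕ)
      (Encodable.encode ([] : List ℕ)))) step, fun i X hX n => ?_⟩
    simp only [Nat.unpair_pair]
    induction n with
    | zero => simp [initSeg]
    | succ n ih =>
      refine (congrArg (fun p : Part ℕ => p.bind _) ih).trans ?_
      simp [hX, initSeg, List.range_succ]
  have test : Primrec fun w : ℕ => if hit w.unpair.1.unpair.1.unpair.2.unpair.1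
      w.unpair.1.unpair.1.unpair.2.unpair.2 w.unpair.1.unpair.2 w.unpair.2 = true
      then 0 else 1 := by
    have k : Primrec fun w : ℕ => w.unpair.1.unpair.2 := u2.comp u1
    have a : Primrec fun w : ℕ => w.unpair.1.unpair.1.unpair.2 := u2.comp (u1.comp u1)
    have ev := Code.primrec_evaln.comp ((((u1.comp (u2.comp k)).pair
      ((Primrec.ofNat Code).comp (u1.comp a))).pair (Primrec₂.natPair.comp (u2.comp a) u2)))
    have h := Primrec.ite (PrimrecRel.comp Primrec.eq ev
      (Primrec.option_some.comp (u1.comp k))) (Primrec.const 0) (Primrec.const 1)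
    exact h.of_eq fun w => by simp [hit]
  have search := Nat.RecursiveIn.rfind (Nat.RecursiveIn.comp (recIn_computable test.to_comp)
    (recIn_pair_part (recIn_computable .id) (recIn_precomp hL (recIn_computable
      (Primrec₂.natPair.comp (u1.comp u1) (u2.comp (u2.comp u2))).to_comp))))
  refine ⟨_, recIn_map search u1.to_comp, fun i X hX d x => ?_⟩
  simp [phi, eL i X hX]

theorem recIn_phi (X : Set ℕ) :
    Nat.RecursiveIn {oracleOf X} fun n => phi X n.unpair.1 n.unpair.2 := by
  obtain ⟨V, hV, eV⟩ := recIn_phi_uniform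
    (recIn_precomp (recIn_chi X) (recIn_computable (Computable.snd.comp Computable.unpair)))
  refine (recIn_precomp hV (recIn_computable
    (Primrec₂.natPair.to_comp.comp (Computable.const 0) Computable.id))).of_eq fun n => ?_
  have := eV 0 X (fun j => by simp) n.unpair.1 n.unpair.2
  simpa using this

theorem setTuringLE_iff_exists_phi {C X : Set ℕ} :
    SetTuringLE C X ↔ ∃ d, ∀ x, chi C x ∈ phi X d x := by
  constructor
  · intro h
    obtain ⟨s, -, hs⟩ := exists_phi_eq (recIn_precomp (setTuringLE_iff.1 h)
      (recIn_computable (Computable.snd.comp Computable.unpair)))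
    exact ⟨s 0, fun x => by simp [hs]⟩
  · rintro ⟨d, hd⟩
    refine setTuringLE_iff.2 ((recIn_precomp (recIn_phi X) (recIn_computable
      (Primrec₂.natPair.to_comp.comp (Computable.const d) Computable.id))).of_eq fun x => ?_)
    simpa using Part.eq_some_iff.2 (hd x)

/-! ### Indices of the members of an interval -/

section Interval

variable (A B : Set ℕ)

/-- The indices of the total functions recursive in `B`. -/
def totalIndices : Set ℕ := {e | ∀ x, (phi B e x).Dom}

/-- The set with index `e`: the join of `A` with the set of the numbers at which `phi B e` takes
the value `1`. -/
def indexedSet (e : ℕ) : Set ℕ := setJoin A {x | 1 ∈ phi B e x}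

variable {A B}

theorem totalIndices_le : SetTuringLE (totalIndices B) (jumpSet (jumpSet B)) := by
  have h : REPredIn B (· ∈ {n : ℕ | (phi B n.unpair.1 n.unpair.2).Dom}) :=
    rePredIn_of_dom (recIn_phi B) fun _ => Iff.rfl
  simpa [totalIndices] using h.forall_le_jumpSet_jumpSet

/-- On total indices, the sets `indexedSet A B e` are recursive in `B` uniformly in `e`. -/
theorem exists_recIn_chi_indexedSet (hAB : SetTuringLE A B) :
    ∃ S : ℕ →. ℕ, Nat.RecursiveIn {oracleOf B} S ∧
      (∀ e ∈ totalIndices B, ∀ x, S (Nat.pair e x) = Part.some (chi (indexedSet A B e) x)) := by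
  have u := Primrec.unpair
  have u1 : Primrec fun z : ℕ => z.unpair.1 := Primrec.fst.comp u
  have u2 : Primrec fun z : ℕ => z.unpair.2 := Primrec.snd.comp u
  have half : Primrec fun n : ℕ => n.unpair.2 / 2 := Primrec.nat_div.comp u2 (.const 2)
  have sel : Primrec fun w : ℕ => if w.unpair.1 % 2 = 0 then w.unpair.2.unpair.1
      else if w.unpair.2.unpair.2 = 1 then 1 else 0 :=
    Primrec.ite (PrimrecRel.comp Primrec.eq (Primrec.nat_mod.comp u1 (.const 2)) (.const 0))
      (u1.comp u2) (Primrec.ite (PrimrecRel.comp Primrec.eq (u2.comp u2) (.const 1))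
        (.const 1) (.const 0))
  refine ⟨_, recIn_map (recIn_pair_part (recIn_computable u2.to_comp) (recIn_pair_part
    (recIn_precomp (setTuringLE_iff.1 hAB) (recIn_computable half.to_comp))
    (recIn_precomp (recIn_phi B) (recIn_computable (Primrec₂.natPair.comp u1 half).to_comp))))
    sel.to_comp, fun e he x => ?_⟩
  obtain ⟨v, hv⟩ := Part.dom_iff_mem.1 (he (x / 2))
  have hv' := Part.eq_some_iff.2 hv
  simp only [Nat.unpair_pair, hv', Part.map_some, Part.bind_some, indexedSet, chi_setJoin]
  congr 2
  simp [chi, hv', eq_comm]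

theorem exists_indexedSet_eq {Y : Set ℕ} (hY : SetTuringLE Y B) :
    ∃ e ∈ totalIndices B, indexedSet A B e = setJoin A Y := by
  obtain ⟨e, he⟩ := setTuringLE_iff_exists_phi.1 hY
  refine ⟨e, fun x => Part.dom_iff_mem.2 ⟨_, he x⟩, ?_⟩
  have : {x | 1 ∈ phi B e x} = Y := by
    ext x
    rw [Set.mem_ofPred_eq, Part.eq_some_iff.2 (he x)]
    simp [chi]
  rw [indexedSet, this]

theorem indexedSet_le (hAB : SetTuringLE A B) {e : ℕ} (he : e ∈ totalIndices B) :
    SetTuringLE (indexedSet A B e) B := by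
  obtain ⟨S, hS, eS⟩ := exists_recIn_chi_indexedSet hAB
  refine setTuringLE_iff.2 ((recIn_precomp hS (recIn_computable
    (Primrec₂.natPair.to_comp.comp (Computable.const e) Computable.id))).of_eq fun x => ?_)
  exact eS e he x

theorem exists_join_index (hAB : SetTuringLE A B) :
    ∃ h : ℕ → ℕ, Computable h ∧ ∀ e ∈ totalIndices B, ∀ i ∈ totalIndices B,
      h (Nat.pair e i) ∈ totalIndices B ∧ indexedSet A B (h (Nat.pair e i)) =
        setJoin A (setJoin (indexedSet A B e) (indexedSet A B i)) := by
  obtain ⟨S, hS, eS⟩ := exists_recIn_chi_indexedSet hAB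
  have u := Primrec.unpair
  have u1 : Primrec fun z : ℕ => z.unpair.1 := Primrec.fst.comp u
  have u2 : Primrec fun z : ℕ => z.unpair.2 := Primrec.snd.comp u
  have half : Primrec fun n : ℕ => n.unpair.2 / 2 := Primrec.nat_div.comp u2 (.const 2)
  have side : Primrec fun n : ℕ =>
      if n.unpair.2 % 2 = 0 then n.unpair.1.unpair.1 else n.unpair.1.unpair.2 :=
    Primrec.ite (PrimrecRel.comp Primrec.eq (Primrec.nat_mod.comp u2 (.const 2)) (.const 0))
      (u1.comp u1) (u2.comp u1)
  obtain ⟨h, hh, eh⟩ := exists_phi_eq (recIn_precomp hS (recIn_computable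
    (Primrec₂.natPair.comp side half).to_comp))
  refine ⟨h, hh, fun e he i hi => ?_⟩
  have key : ∀ x, phi B (h (Nat.pair e i)) x =
      Part.some (chi (setJoin (indexedSet A B e) (indexedSet A B i)) x) := by
    intro x
    rw [eh, chi_setJoin]
    simp only [Nat.unpair_pair]
    split_ifs
    exacts [eS e he _, eS i hi _]
  refine ⟨fun x => by simp [key], ?_⟩
  have : {x | 1 ∈ phi B (h (Nat.pair e i)) x} =
      setJoin (indexedSet A B e) (indexedSet A B i) := by
    ext x
    simp [key, chi]
  rw [indexedSet, this]

/-- Reducibility between indexed sets is `Σ⁰₃` in `B` on the total indices: it says that for some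
`d` and every `x`, the computation of `phi (indexedSet A B i) d x` halts with the right value. -/
theorem exists_rePredIn_indexedSet_le (hAB : SetTuringLE A B) :
    ∃ Q : ℕ → Prop, REPredIn (jumpSet (jumpSet B)) Q ∧
      ∀ e ∈ totalIndices B, ∀ i ∈ totalIndices B, (Q (Nat.pair e i) ↔
        SetTuringLE (indexedSet A B e) (indexedSet A B i)) := by
  obtain ⟨S, hS, eS⟩ := exists_recIn_chi_indexedSet hAB
  obtain ⟨V, hV, eV⟩ := recIn_phi_uniform hS
  have u := Primrec.unpair
  have u1 : Primrec fun z : ℕ => z.unpair.1 := Primrec.fst.comp u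
  have u2 : Primrec fun z : ℕ => z.unpair.2 := Primrec.snd.comp u
  -- The input `z` is read as `⟨⟨⟨e, i⟩, d⟩, x⟩`.
  have c₁ : Primrec fun z : ℕ => Nat.pair z.unpair.1.unpair.1.unpair.1 z.unpair.2 :=
    Primrec₂.natPair.comp (u1.comp (u1.comp u1)) u2
  have c₂ : Primrec fun z : ℕ => Nat.pair z.unpair.1.unpair.1.unpair.2
      (Nat.pair z.unpair.1.unpair.2 z.unpair.2) :=
    Primrec₂.natPair.comp (u2.comp (u1.comp u1)) (Primrec₂.natPair.comp (u2.comp u1) u2)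
  have cmp : Primrec fun w : ℕ => if w.unpair.1 = w.unpair.2 then 0 else 1 :=
    Primrec.ite (PrimrecRel.comp Primrec.eq u1 u2) (.const 0) (.const 1)
  have hP := rePredIn_zero_mem (recIn_map (recIn_pair_part
    (recIn_precomp hS (recIn_computable c₁.to_comp))
    (recIn_precomp hV (recIn_computable c₂.to_comp))) cmp.to_comp)
  refine ⟨_, rePredIn_exists (REPredIn.forall_le_jumpSet_jumpSet (C := {n | _}) hP),
    fun e he i hi => ?_⟩
  rw [setTuringLE_iff_exists_phi]
  refine exists_congr fun d => forall_congr' fun x => ?_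
  simp only [Set.mem_ofPred_eq, Nat.unpair_pair, eS e he, eV i _ (eS i hi), Part.bind_some,
    Part.map_map]
  refine (Part.mem_map_iff _).trans ?_
  constructor
  · rintro ⟨a, ha, h0⟩
    have : chi (indexedSet A B e) x = a := by simpa using h0
    exact this ▸ ha
  · exact fun h => ⟨_, h, by simp⟩

end Interval

/-! ### The presentation -/

theorem lemma2p2 (a b : Degree) (hab : a ≤ b) :
    haveI : Fact (a ≤ b) := ⟨hab⟩
    SigmaSuccPresentable 2 b (Set.Icc a b) := by
  obtain ⟨A, rfl⟩ := Quotient.exists_rep a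
  obtain ⟨B, rfl⟩ := Quotient.exists_rep b
  change SetTuringLE A B at hab
  have : Fact (degree A ≤ degree B) := ⟨hab⟩
  obtain ⟨h, hh, eh⟩ := exists_join_index hab
  obtain ⟨Q, hQ, eQ⟩ := exists_rePredIn_indexedSet_le hab
  obtain ⟨e₀, he₀, -⟩ := exists_indexedSet_eq (A := A) (TuringReducible.rfl : SetTuringLE B B)
  -- `N` replaces every index of a partial function by a fixed total index.
  let N : ℕ → ℕ := fun e => if chi (totalIndices B) e = 1 then e else e₀
  have hN : ∀ e, N e ∈ totalIndices B := by
    intro e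
    by_cases he : e ∈ totalIndices B <;> simp [N, chi, he, he₀]
  have N_eq : ∀ e ∈ totalIndices B, N e = e := fun e he => by simp [N, chi, he]
  have recN : Nat.RecursiveIn {oracleOf (jumpSet (jumpSet B))} fun e => Part.some (N e) := by
    have u := Primrec.unpair
    have sel : Primrec fun w : ℕ => if w.unpair.2 = 1 then w.unpair.1 else e₀ :=
      Primrec.ite (PrimrecRel.comp Primrec.eq (Primrec.snd.comp u) (.const 1))
        (Primrec.fst.comp u) (.const e₀)
    exact (recIn_comp (recIn_computable sel.to_comp) (recIn_pair (recIn_computable .id)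
      (setTuringLE_iff.1 totalIndices_le))).of_eq fun e => by simp [N]
  have recNN : Nat.RecursiveIn {oracleOf (jumpSet (jumpSet B))} fun n =>
      Part.some (Nat.pair (N n.unpair.1) (N n.unpair.2)) :=
    recIn_pair (recIn_comp recN (recIn_computable (Computable.fst.comp Computable.unpair)))
      (recIn_comp recN (recIn_computable (Computable.snd.comp Computable.unpair)))
  let D : ℕ → Degree := fun e => degree (indexedSet A B (N e))
  have D_mem : ∀ e, D e ∈ Set.Icc (degree A) (degree B) := fun e =>
    ⟨left_le_setJoin _ _, indexedSet_le hab (hN e)⟩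
  have D_join : ∀ e i, D (h (Nat.pair (N e) (N i))) = D e ⊔ D i := by
    intro e i
    obtain ⟨h₁, h₂⟩ := eh _ (hN e) _ (hN i)
    have : D (h (Nat.pair (N e) (N i))) = degree A ⊔ (D e ⊔ D i) := by
      simp only [D]
      rw [N_eq _ h₁, h₂]
      rfl
    rw [this]
    exact sup_eq_right.2 ((D_mem e).1.trans le_sup_left)
  let P : Presentation :=
    { le' := fun e i => D e ≤ D i
      join' := fun e i => h (Nat.pair (N e) (N i))
      refl' := fun _ => le_rfl
      trans' := fun _ _ _ => le_trans
      join_congr' := by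
        intro i₁ i₂ j₁ j₂ hi hj
        have : D (h (Nat.pair (N i₁) (N j₁))) = D (h (Nat.pair (N i₂) (N j₂))) := by
          rw [D_join, D_join, le_antisymm hi.1 hi.2, le_antisymm hj.1 hj.2]
        exact ⟨this.le, this.ge⟩ }
  let φ : P.Carrier → Set.Icc (degree A) (degree B) :=
    Quotient.lift (fun e => ⟨D e, D_mem e⟩) fun _ _ he =>
      Subtype.ext (le_antisymm he.1 he.2)
  have φ_bij : Function.Bijective φ := by
    constructor
    · rintro ⟨e⟩ ⟨i⟩ hei
      have : D e = D i := congrArg Subtype.val hei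
      exact Quotient.sound ⟨this.le, this.ge⟩
    · rintro ⟨y, hAy, hyB⟩
      obtain ⟨Y, rfl⟩ := Quotient.exists_rep y
      obtain ⟨e, he, heY⟩ := exists_indexedSet_eq (A := A) (show SetTuringLE Y B from hyB)
      refine ⟨Quotient.mk _ e, Subtype.ext ?_⟩
      change degree (indexedSet A B (N e)) = degree Y
      rw [N_eq e he, heY]
      exact sup_eq_right.2 hAy
  refine ⟨jumpSet (jumpSet B), P, rfl, ?_, ?_, Equiv.ofBijective φ φ_bij, ?_, ?_⟩
  · have hle : REPredIn (jumpSet (jumpSet B)) fun p : ℕ × ℕ =>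
        Q (Nat.pair (N p.1) (N p.2)) := by
      refine hQ.precomp (recNN.of_eq fun n => ?_)
      simp
    convert hle using 2 with p
    exact (eQ _ (hN p.1) _ (hN p.2)).symm
  · refine (recIn_comp (recIn_computable hh) recNN).of_eq fun n => ?_
    simp [P]
  · rintro ⟨e⟩ ⟨i⟩
    exact Iff.rfl
  · rintro ⟨e⟩ ⟨i⟩
    exact Subtype.ext (D_join e i)
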